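/- **Definitions.** A *geodesic segment* joining points $x,y$ of a metric space $X$ is (the image of) an isometric inclusion $g:[0,d(x,y)]\to X$ with $g(0)=x$, $g(d(x,y))=y$; $X$ is *geodesic* if any two of its points are joined by a geodesic segment. A *real tree* is a metric space in which (1) any two distinct points are joined by a unique geodesic segment, and (2) if two geodesic segments $[a,b]$, $[b,c]$ have exactly the endpoint $b$ in common, then their union is a geodesic segment joining $a$ to $c$. A *vertex* of a real tree $T$ is a point $x$ which is either a branch point ($T\setminus\{x\}$ has at least three connected components) or an endpoint ($T\setminus\{x\}$ has at most one component). A real tree is *thick* if every real tree with countably many vertices and at most continuum many points admits an isometric (distance-preserving) map into it. A metric space is *homogeneous* if for any two of its points some bijective isometry of the space onto itself moves the first to the second. Given a metric space $X$ of infinite diameter, a metric space $T$ is *isometrically embedded at infinity* into $X$ if there are positive numbers $\varepsilon_i\to 0$ and, for every $t\in T$, a sequence $(x_t^i)_i$ in $X$ such that $\lim_{i\to\infty}\varepsilon_i\, d_X(x_{t_1}^i,x_{t_2}^i)=d_T(t_1,t_2)$ for all $t_1,t_2\in T$; a metric space $X_0$ is an *asymptotic subcone* of $X$ if $X_0$ is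 geodesic and every finite subset of $X_0$ can be isometrically embedded at infinity into $X$. Let $S$ be the set of all continuous functions $f:[0,\rho]\to\mathbb R$ with $f(0)=0$, where $0\le\rho<\infty$ depends on $f$. For $f_1,f_2\in S$ with domains $[0,\rho_1],[0,\rho_2]$ put $$d_S(f_1,f_2)=(\rho_1-s)+(\rho_2-s),\qquad s=\sup\{t\in[0,\min(\rho_1,\rho_2)] : f_1(t')=f_2(t')\ \text{for all } 0\le t'<t\}.$$ This is a metric on $S$. **Theorem.** The metric space $S$ is a real tree, it is thick, and it is homogeneous. Moreover, $S$ is an asymptotic subcone of the hyperbolic plane. -/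

import Mathlib

open Set Filter Topology

universe u v

/-! ### Geodesic segments, geodesic spaces, real trees -/

/-- `σ` is (the image of) a geodesic segment connecting `x` to `y`: it is the image of an isometric
inclusion `g : [0, d(x, y)] → X` with `g 0 = x` and `g (d(x, y)) = y`.
(Only the restriction of `g` to `[0, d(x, y)]` matters.) -/
def IsGeodesicSegment {X : Type u} [MetricSpace X] (x y : X) (σ : Set X) : Prop :=
  ∃ g : ℝ → X,
    (∀ s ∈ Icc (0 : ℝ) (dist x y), ∀ t ∈ Icc (0 : ℝ) (dist x y), dist (g s) (g t) = |s - t|) ∧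
    g 0 = x ∧ g (dist x y) = y ∧ g '' Icc (0 : ℝ) (dist x y) = σ

/-- A metric space is geodesic if any two points are connected by a geodesic segment. -/
def IsGeodesicSpace (X : Type u) [MetricSpace X] : Prop :=
  ∀ x y : X, ∃ σ : Set X, IsGeodesicSegment x y σ

/-- A real tree: any two distinct points are joined by a unique geodesic segment, and if two
geodesic segments `[a, b]`, `[b, c]` have only the endpoint `b` in common, then their union is a
geodesic segment (joining `a` to `c`). -/
def IsRealTree (X : Type u) [MetricSpace X] : Prop :=
  (∀ x y : X, x ≠ y → ∃! σ : Set X, IsGeodesicSegment x y σ) ∧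
  (∀ (a b c : X) (σ τ : Set X), IsGeodesicSegment a b σ → IsGeodesicSegment b c τ →
    σ ∩ τ = {b} → IsGeodesicSegment a c (σ ∪ τ))

/-! ### Vertices and thick trees -/

/-- `x` separates `a` from `b`: both are different from `x`, and `x` lies metrically between them.
In a real tree this says that `x` is an interior point of the geodesic segment `[a, b]`, that is,
`a` and `b` lie in different connected components of the complement of `x`. -/
def Separates {T : Type u} [MetricSpace T] (x a b : T) : Prop :=
  a ≠ x ∧ b ≠ x ∧ dist a x + dist x b = dist a b

/-- `x` is a branch point: its complement has at least three components. -/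
def IsBranchPoint {T : Type u} [MetricSpace T] (x : T) : Prop :=
  ∃ a b c : T, Separates x a b ∧ Separates x b c ∧ Separates x a c

/-- `x` is an endpoint: it is not an interior point of any geodesic segment, that is, its
complement has at most one component. -/
def IsEndpoint {T : Type u} [MetricSpace T] (x : T) : Prop :=
  ¬ ∃ a b : T, Separates x a b

/-- The vertices of a real tree: the branch points and the endpoints, that is, the points whose
complement does not have exactly two components. -/
def treeVertices (T : Type u) [MetricSpace T] : Set T :=
  {x | IsBranchPoint x ∨ IsEndpoint x}

/-- A real tree is thick if every real tree with countably many vertices (and at most continuum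
many points) admits an isometric inclusion into it. The cardinality restriction only excludes trees
such as the star of more than continuum many half-open segments `[0, 1)` with a common origin, which
has one vertex; it is automatic when the tree is the union of the segments joining countably many
of its points. -/
def IsThick (X : Type u) [MetricSpace X] : Prop :=
  IsRealTree X ∧
  ∀ (T : Type v) [MetricSpace T], IsRealTree T → (treeVertices T).Countable →
    Cardinal.mk T ≤ Cardinal.continuum → ∃ φ : T → X, Isometry φ

/-! ### Homogeneous spaces -/

/-- For every two points there is a bijective isometry moving the first one to the second one. -/
def IsHomogeneousSpace (X : Type u) [MetricSpace X] : Prop :=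
  ∀ x y : X, ∃ e : X ≃ᵢ X, e x = y

/-! ### Asymptotic subcones -/

/-- `T` can be isometrically embedded at infinity into `X`. -/
def EmbedsAtInfinity (T : Type u) [MetricSpace T] (X : Type v) [MetricSpace X] : Prop :=
  ∃ ε : ℕ → ℝ, (∀ i, 0 < ε i) ∧ Tendsto ε atTop (𝓝 0) ∧
    ∃ x : T → ℕ → X, ∀ t₁ t₂ : T,
      Tendsto (fun i => ε i * dist (x t₁ i) (x t₂ i)) atTop (𝓝 (dist t₁ t₂))

/-- `X₀` is an asymptotic subcone of the space `X` of infinite diameter: `X₀` is geodesic and each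
of its finite subsets can be isometrically embedded at infinity into `X`. -/
def IsAsymptoticSubcone (X₀ : Type u) [MetricSpace X₀] (X : Type v) [MetricSpace X] : Prop :=
  (∀ C : ℝ, ∃ x y : X, C < dist x y) ∧
  IsGeodesicSpace X₀ ∧ ∀ F : Set X₀, F.Finite → EmbedsAtInfinity F X

/-! ### The space `S` -/

/-- A point of `S`: a continuous function `f` on an interval `[0, ρ]`, `0 ≤ ρ < ∞`, with `f 0 = 0`.
The function is represented by its extension by zero to the whole line, so that two points are equal
exactly when they have the same `ρ` and the same values on `[0, ρ]`. -/
@[ext]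
structure PathSpace where
  ρ : ℝ
  toFun : ℝ → ℝ
  ρ_nonneg : 0 ≤ ρ
  continuousOn_toFun : ContinuousOn toFun (Icc 0 ρ)
  map_zero : toFun 0 = 0
  eq_zero_of_notMem : ∀ t, t ∉ Icc 0 ρ → toFun t = 0

namespace PathSpace

/-- The times `t` in both domains up to which the two functions agree. -/
def agreeSet (f₁ f₂ : PathSpace) : Set ℝ :=
  {t | 0 ≤ t ∧ t ≤ f₁.ρ ∧ t ≤ f₂.ρ ∧ ∀ t', 0 ≤ t' → t' < t → f₁.toFun t' = f₂.toFun t'}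

/-- The moment of segregation of two functions. -/
noncomputable def segregation (f₁ f₂ : PathSpace) : ℝ := sSup (agreeSet f₁ f₂)

theorem agreeSet_comm (f₁ f₂ : PathSpace) : agreeSet f₁ f₂ = agreeSet f₂ f₁ := by
  ext t
  exact ⟨fun h => ⟨h.1, h.2.2.1, h.2.1, fun t' a b => (h.2.2.2 t' a b).symm⟩,
    fun h => ⟨h.1, h.2.2.1, h.2.1, fun t' a b => (h.2.2.2 t' a b).symm⟩⟩

theorem zero_mem_agreeSet (f₁ f₂ : PathSpace) : (0 : ℝ) ∈ agreeSet f₁ f₂ :=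
  ⟨le_rfl, f₁.ρ_nonneg, f₂.ρ_nonneg, fun _ h h' => absurd h (not_le.mpr h')⟩

theorem bddAbove_agreeSet (f₁ f₂ : PathSpace) : BddAbove (agreeSet f₁ f₂) :=
  ⟨f₁.ρ, fun _ h => h.2.1⟩

theorem segregation_mem (f₁ f₂ : PathSpace) : segregation f₁ f₂ ∈ agreeSet f₁ f₂ := by
  have hne : (agreeSet f₁ f₂).Nonempty := ⟨0, zero_mem_agreeSet f₁ f₂⟩
  refine ⟨le_csSup (bddAbove_agreeSet f₁ f₂) (zero_mem_agreeSet f₁ f₂),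
    csSup_le hne fun _ h => h.2.1, csSup_le hne fun _ h => h.2.2.1, fun t' h0 ht => ?_⟩
  obtain ⟨t, ht1, ht2⟩ := exists_lt_of_lt_csSup hne ht
  exact ht1.2.2.2 t' h0 ht2

theorem segregation_self (f : PathSpace) : segregation f f = f.ρ :=
  le_antisymm (segregation_mem f f).2.1
    (le_csSup (bddAbove_agreeSet f f) ⟨f.ρ_nonneg, le_rfl, le_rfl, fun _ _ _ => rfl⟩)

theorem min_segregation_le (f₁ f₂ f₃ : PathSpace) :
    min (segregation f₁ f₂) (segregation f₂ f₃) ≤ segregation f₁ f₃ := by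
  have h := segregation_mem f₁ f₂
  have h' := segregation_mem f₂ f₃
  refine le_csSup (bddAbove_agreeSet f₁ f₃) ⟨le_min h.1 h'.1, (min_le_left _ _).trans h.2.1,
    (min_le_right _ _).trans h'.2.2.1, fun t h0 ht => ?_⟩
  exact (h.2.2.2 t h0 (ht.trans_le (min_le_left _ _))).trans
    (h'.2.2.2 t h0 (ht.trans_le (min_le_right _ _)))

theorem eq_of_segregation {f₁ f₂ : PathSpace} (h₁ : segregation f₁ f₂ = f₁.ρ)
    (h₂ : segregation f₁ f₂ = f₂.ρ) : f₁ = f₂ := by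
  have hρ : f₁.ρ = f₂.ρ := h₁.symm.trans h₂
  have hag := (segregation_mem f₁ f₂).2.2.2
  rw [h₁] at hag
  refine PathSpace.ext hρ (funext fun t => ?_)
  by_cases ht : t ∈ Icc 0 f₁.ρ
  · rcases ht.2.lt_or_eq with hlt | rfl
    · exact hag t ht.1 hlt
    · rcases f₁.ρ_nonneg.eq_or_lt with h0 | h0
      · rw [← h0, f₁.map_zero, f₂.map_zero]
      · have c₁ := f₁.continuousOn_toFun
        have c₂ := f₂.continuousOn_toFun
        rw [← hρ] at c₂
        have hE : EqOn f₁.toFun f₂.toFun (Ico 0 f₁.ρ) := fun s hs => hag s hs.1 hs.2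
        exact hE.of_subset_closure c₁ c₂ Ico_subset_Icc_self
          (by rw [closure_Ico h0.ne]) ht
  · rw [f₁.eq_zero_of_notMem t ht, f₂.eq_zero_of_notMem t (hρ ▸ ht)]

/-- The metric `d(f₁, f₂) = (ρ₁ - s) + (ρ₂ - s)`, `s` the moment of segregation. -/
noncomputable instance : MetricSpace PathSpace where
  dist f₁ f₂ := (f₁.ρ - segregation f₁ f₂) + (f₂.ρ - segregation f₁ f₂)
  dist_self f := by simp [segregation_self]
  dist_comm f₁ f₂ := by
    simp only [segregation, agreeSet_comm f₁ f₂]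
    ring
  dist_triangle f₁ f₂ f₃ := by
    have h := min_segregation_le f₁ f₂ f₃
    have h₁ := (segregation_mem f₁ f₂).2.2.1
    have h₂ := (segregation_mem f₂ f₃).2.1
    rcases min_choice (segregation f₁ f₂) (segregation f₂ f₃) with h' | h' <;>
      rw [h'] at h <;> linarith
  eq_of_dist_eq_zero {f₁ f₂} h := by
    have h₁ := (segregation_mem f₁ f₂).2.1
    have h₂ := (segregation_mem f₁ f₂).2.2.1
    change (f₁.ρ - segregation f₁ f₂) + (f₂.ρ - segregation f₁ f₂) = 0 at h
    exact eq_of_segregation (by linarith) (by linarith)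

end PathSpace

/-! ### Geodesic segments in metric spaces -/

section Segments

variable {X : Type u} [MetricSpace X] {x y z : X} {σ τ : Set X}

/-! Tree: segregation times satisfy the ultrametric inequality `min_segregation_le`, which yields
the four point condition. A geodesic runs back along one path to the common initial piece and out
along the other. A geodesic space with the four point condition is a real tree.

Homogeneity: adding a continuous function carries a zero path to any path of the same length, so
only the length must be changed. A path is determined by the time `s` at which it leaves the zero
path of length `r` and by the branch it then follows. At `s < r` the branches are the paths that do
not start as zero, at `s = r` all paths. A Hilbert hotel shift on initial slopes (`lowerSlope`)
identifies the two families isometrically, after which `s ↦ r - s` is an isometry.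

Subcone: in the half plane at scale `R`, a path of length `ρ` goes to height `exp (-R ρ)`. The real
parts, sums of `exp (-R * segregation f k)` with weights powers of two, make two points differ
horizontally by the exact order `exp (-R s)`, `s` their segregation. The hyperbolic distance is then
asymptotic to `R` times the tree distance.

Thickness: root the tree at `r` and label the branches at each point by reals. A point `t` goes to a
function on `[0, dist r t]` that sums, over the root and the countably many vertices, a small ramp
starting at the height of the vertex, times the label of the branch containing `t`. Two such
functions separate exactly at the Gromov product, because the amplitudes of `exists_amplitude`
prevent nearby vertices from cancelling the ramp at the branching point. -/

theorem IsGeodesicSegment.dist_add_dist (h : IsGeodesicSegment x y σ) (hz : z ∈ σ) :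
    dist x z + dist z y = dist x y := by
  obtain ⟨g, hg, h0, h1, rfl⟩ := h
  obtain ⟨u, hu, rfl⟩ := hz
  have h2 := hg 0 ⟨le_rfl, dist_nonneg⟩ u hu
  have h3 := hg u hu _ ⟨dist_nonneg, le_rfl⟩
  rw [h0] at h2
  rw [h1] at h3
  rw [h2, h3, abs_of_nonpos (by linarith [hu.1]), abs_of_nonpos (by linarith [hu.2])]
  ring

theorem IsGeodesicSegment.exists_mem (h : IsGeodesicSegment x y σ) {u : ℝ}
    (hu : u ∈ Icc 0 (dist x y)) : ∃ w ∈ σ, dist x w = u := by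
  obtain ⟨g, hg, h0, h1, rfl⟩ := h
  refine ⟨g u, mem_image_of_mem _ hu, ?_⟩
  have h2 := hg 0 ⟨le_rfl, dist_nonneg⟩ u hu
  rw [h0] at h2
  rw [h2, abs_of_nonpos (by linarith [hu.1])]
  ring

theorem IsGeodesicSegment.left_mem (h : IsGeodesicSegment x y σ) : x ∈ σ := by
  obtain ⟨g, hg, h0, h1, rfl⟩ := h
  exact ⟨0, ⟨le_rfl, dist_nonneg⟩, h0⟩

theorem IsGeodesicSegment.right_mem (h : IsGeodesicSegment x y σ) : y ∈ σ := by
  obtain ⟨g, hg, h0, h1, rfl⟩ := h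
  exact ⟨_, ⟨dist_nonneg, le_rfl⟩, h1⟩

theorem isGeodesicSegment_self (x : X) : IsGeodesicSegment x x {x} :=
  ⟨fun _ => x, fun s hs t ht => by
    rw [dist_self] at hs ht ⊢
    rw [le_antisymm hs.2 hs.1, le_antisymm ht.2 ht.1]
    simp, rfl, rfl, by simp⟩

theorem IsGeodesicSegment.symm (h : IsGeodesicSegment x y σ) : IsGeodesicSegment y x σ := by
  obtain ⟨g, hg, h0, h1, rfl⟩ := h
  have hmem : ∀ s ∈ Icc 0 (dist x y), dist x y - s ∈ Icc 0 (dist x y) := fun s hs =>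
    ⟨by linarith [hs.2], by linarith [hs.1]⟩
  refine ⟨fun t => g (dist x y - t), ?_, by simpa using h1, by simp [dist_comm y x, h0], ?_⟩
  · rw [dist_comm y x]
    intro s hs t ht
    rw [hg _ (hmem s hs) _ (hmem t ht), abs_sub_comm s t]
    congr 1
    ring
  · rw [dist_comm y x]
    ext w
    constructor
    · rintro ⟨t, ht, rfl⟩
      exact ⟨_, hmem t ht, rfl⟩
    · rintro ⟨t, ht, rfl⟩
      exact ⟨_, hmem t ht, by simp⟩

theorem IsGeodesicSegment.union (h₁ : IsGeodesicSegment x z σ) (h₂ : IsGeodesicSegment z y τ)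
    (hd : dist x z + dist z y = dist x y) : IsGeodesicSegment x y (σ ∪ τ) := by
  obtain ⟨g, hg, g0, g1, rfl⟩ := h₁
  obtain ⟨k, hk, k0, k1, rfl⟩ := h₂
  set a := dist x z with ha
  set b := dist z y with hb
  have ha0 : 0 ≤ a := dist_nonneg
  have hb0 : 0 ≤ b := dist_nonneg
  -- The upper bound goes through `z`; the lower bound holds because a shorter route would shorten
  -- the way from `x` to `y`, against `hd`.
  have hcross : ∀ s ∈ Icc 0 a, ∀ t ∈ Icc 0 b, dist (g s) (k t) = a - s + t := by
    intro s hs t ht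
    have e1 := hg 0 ⟨le_rfl, ha0⟩ s hs
    have e2 := hg s hs a ⟨ha0, le_rfl⟩
    have e3 := hk 0 ⟨le_rfl, hb0⟩ t ht
    have e4 := hk t ht b ⟨hb0, le_rfl⟩
    rw [g0, abs_of_nonpos (by linarith [hs.1])] at e1
    rw [g1, abs_of_nonpos (by linarith [hs.2])] at e2
    rw [k0, abs_of_nonpos (by linarith [ht.1])] at e3
    rw [k1, abs_of_nonpos (by linarith [ht.2])] at e4
    have i1 := dist_triangle (g s) z (k t)
    have i2 := dist_triangle4 x (g s) (k t) y
    linarith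
  refine ⟨fun t => if t ≤ a then g t else k (t - a), ?_, by simp [ha0, g0], ?_, ?_⟩
  · rw [← hd]
    intro s hs t ht
    by_cases hsa : s ≤ a <;> by_cases hta : t ≤ a <;> simp only [hsa, hta, if_true, if_false]
    · exact hg s ⟨hs.1, hsa⟩ t ⟨ht.1, hta⟩
    · rw [hcross s ⟨hs.1, hsa⟩ (t - a) ⟨by linarith, by linarith [ht.2]⟩,
        abs_of_nonpos (by linarith)]
      ring
    · rw [dist_comm, hcross t ⟨ht.1, hta⟩ (s - a) ⟨by linarith, by linarith [hs.2]⟩,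
        abs_of_nonneg (by linarith)]
      ring
    · rw [hk (s - a) ⟨by linarith, by linarith [hs.2]⟩ (t - a) ⟨by linarith, by linarith [ht.2]⟩]
      congr 1
      ring
  · rw [← hd]
    rcases hb0.eq_or_lt with h0 | h0
    · rw [← h0] at k1
      simp [← h0, g1, ← k0, ← k1]
    · simp [h0, k1]
  · rw [← hd]
    ext w
    constructor
    · rintro ⟨t, ht, rfl⟩
      by_cases hta : t ≤ a
      · exact Or.inl ⟨t, ⟨ht.1, hta⟩, by simp [hta]⟩
      · exact Or.inr ⟨t - a, ⟨by linarith, by linarith [ht.2]⟩, by simp [hta]⟩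
    · rintro (⟨t, ht, rfl⟩ | ⟨t, ht, rfl⟩)
      · exact ⟨t, ⟨ht.1, by linarith [ht.2]⟩, by simp [ht.2]⟩
      · refine ⟨a + t, ⟨by linarith [ht.1], by linarith [ht.2]⟩, ?_⟩
        rcases ht.1.eq_or_lt with h0 | h0
        · simp [← h0, g1, k0]
        · simp [h0]

end Segments

/-! ### Geodesic spaces with the four point condition are real trees -/

/-- The four point condition: of the three sums of opposite distances, the two largest ones are
equal. -/
def FourPointCondition (X : Type u) [MetricSpace X] : Prop :=
  ∀ x y z w : X, dist x y + dist z w ≤ max (dist x z + dist y w) (dist x w + dist y z)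

section FourPoint

variable {X : Type u} [MetricSpace X] {x y z w : X} {σ : Set X}

theorem FourPointCondition.eq_of_dist_eq (h : FourPointCondition X)
    (hz : dist x z + dist z y = dist x y) (hw : dist x w + dist w y = dist x y)
    (e : dist x z = dist x w) : z = w := by
  have h1 := h z w x y
  rw [dist_comm z x, dist_comm w x] at h1
  refine dist_le_zero.1 ?_
  rcases le_max_iff.1 h1 with h2 | h2 <;> linarith

theorem IsGeodesicSegment.eq_setOf (hσ : IsGeodesicSegment x y σ) (h : FourPointCondition X) :
    σ = {z | dist x z + dist z y = dist x y} := by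
  refine Subset.antisymm (fun z hz => hσ.dist_add_dist hz) fun z (hz : _ = _) => ?_
  obtain ⟨w, hw, e⟩ := hσ.exists_mem (u := dist x z)
    ⟨dist_nonneg, by linarith [dist_nonneg (x := z) (y := y)]⟩
  rwa [h.eq_of_dist_eq hz (hσ.dist_add_dist hw) e.symm]

theorem IsGeodesicSpace.isRealTree (hX : IsGeodesicSpace X) (h : FourPointCondition X) :
    IsRealTree X := by
  refine ⟨fun x y _ => ?_, fun a b c σ τ hσ hτ hb => ?_⟩
  · obtain ⟨σ, hσ⟩ := hX x y
    exact ⟨σ, hσ, fun τ hτ => (hτ.eq_setOf h).trans (hσ.eq_setOf h).symm⟩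
  · refine hσ.union hτ (le_antisymm ?_ (dist_triangle a b c))
    by_contra! hlt
    -- The Gromov product at `b`: if the union were not geodesic, the two segments would run
    -- together up to this positive distance from `b`.
    set p := (dist b a + dist b c - dist a c) / 2 with hp
    have hp0 : 0 < p := by
      rw [hp, dist_comm b a]
      linarith
    have hpa : p ≤ dist b a := by
      have := dist_triangle b a c
      linarith
    have hpc : p ≤ dist b c := by
      have := dist_triangle b c a
      rw [dist_comm c a] at this
      linarith
    obtain ⟨z, hz, ez⟩ := hσ.symm.exists_mem ⟨hp0.le, hpa⟩
    obtain ⟨w, hw, ew⟩ := hτ.exists_mem ⟨hp0.le, hpc⟩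
    have hza := hσ.symm.dist_add_dist hz
    have hzc : dist b z + dist z c = dist b c := by
      refine le_antisymm ?_ (dist_triangle b z c)
      have h1 := h z c a b
      rw [dist_comm a b, dist_comm c b, dist_comm c a, dist_comm z b] at h1
      rcases le_max_iff.1 h1 with h2 | h2 <;> linarith
    have hzw := h.eq_of_dist_eq hzc (hτ.dist_add_dist hw) (ez.trans ew.symm)
    have : z ∈ σ ∩ τ := ⟨hz, hzw ▸ hw⟩
    rw [hb, mem_singleton_iff] at this
    rw [this, dist_self] at ez
    linarith

end FourPoint

/-! ### Geometry of real trees -/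

section RealTree

variable {T : Type u} [MetricSpace T] {x y z w : T} {σ τ : Set T}

theorem IsRealTree.isGeodesicSpace (hT : IsRealTree T) : IsGeodesicSpace T := by
  intro x y
  rcases eq_or_ne x y with rfl | h
  · exact ⟨_, isGeodesicSegment_self x⟩
  · exact (hT.1 x y h).exists

theorem IsRealTree.segment_unique (hT : IsRealTree T) (hσ : IsGeodesicSegment x y σ)
    (hτ : IsGeodesicSegment x y τ) : σ = τ := by
  rcases eq_or_ne x y with rfl | h
  · have key : ∀ ρ : Set T, IsGeodesicSegment x x ρ → ρ = {x} := fun ρ hρ =>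
      eq_singleton_iff_unique_mem.2 ⟨hρ.left_mem, fun z hz => by
        have := hρ.dist_add_dist hz
        rw [dist_self] at this
        exact dist_le_zero.1 (by linarith [dist_nonneg (x := x) (y := z)])⟩
    rw [key σ hσ, key τ hτ]
  · exact (hT.1 x y h).unique hσ hτ

theorem IsRealTree.mem_segment (hT : IsRealTree T) (hσ : IsGeodesicSegment x y σ)
    (hz : dist x z + dist z y = dist x y) : z ∈ σ := by
  obtain ⟨α, hα⟩ := hT.isGeodesicSpace x z
  obtain ⟨β, hβ⟩ := hT.isGeodesicSpace z y
  rw [hT.segment_unique hσ (hα.union hβ hz)]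
  exact Or.inl hα.right_mem

theorem IsRealTree.eq_of_dist_eq (hT : IsRealTree T)
    (hz : dist x z + dist z y = dist x y) (hw : dist x w + dist w y = dist x y)
    (e : dist x z = dist x w) : z = w := by
  obtain ⟨σ, hσ⟩ := hT.isGeodesicSpace x y
  have h1 := hT.mem_segment hσ hz
  have h2 := hT.mem_segment hσ hw
  obtain ⟨g, hg, h0, h1', rfl⟩ := hσ
  have key : ∀ s ∈ Icc 0 (dist x y), dist x (g s) = s := fun s hs => by
    have := hg 0 ⟨le_rfl, dist_nonneg⟩ s hs
    rw [h0] at this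
    rw [this, zero_sub, abs_neg, abs_of_nonneg hs.1]
  obtain ⟨s, hs, rfl⟩ := h1
  obtain ⟨t, ht, rfl⟩ := h2
  rw [key s hs, key t ht] at e
  rw [e]

theorem IsRealTree.dist_add_dist_of_le (hT : IsRealTree T)
    (hz : dist x z + dist z y = dist x y) (hw : dist x w + dist w y = dist x y)
    (h : dist x z ≤ dist x w) : dist x z + dist z w = dist x w := by
  obtain ⟨σ, hσ⟩ := hT.isGeodesicSpace x w
  obtain ⟨v, hv, ev⟩ := hσ.exists_mem ⟨dist_nonneg, h⟩
  have hvw := hσ.dist_add_dist hv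
  have : v = z := by
    refine hT.eq_of_dist_eq ?_ hz ev
    have := dist_triangle x v y
    have := dist_triangle v w y
    linarith
  rwa [this] at hvw

/-- The median of three points of a real tree. -/
theorem IsRealTree.exists_median (hT : IsRealTree T) (r a b : T) :
    ∃ p, dist r p + dist p a = dist r a ∧ dist r p + dist p b = dist r b ∧
      dist a p + dist p b = dist a b := by
  obtain ⟨σ, hσ⟩ := hT.isGeodesicSpace r a
  obtain ⟨τ, hτ⟩ := hT.isGeodesicSpace r b
  have hcompact : ∀ {x y : T} {ρ : Set T}, IsGeodesicSegment x y ρ → IsCompact ρ := by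
    rintro x y ρ ⟨g, hg, -, -, rfl⟩
    refine isCompact_Icc.image_of_continuousOn ?_
    refine LipschitzOnWith.continuousOn (K := 1) (LipschitzOnWith.of_dist_le_mul fun s hs t ht => ?_)
    rw [hg s hs t ht, Real.dist_eq]
    simp
  -- The median is the last common point of the two segments from `r`. By maximality `[a, p]` and
  -- `[p, b]` meet only in `p`, so the second tree axiom applies.
  obtain ⟨p, ⟨hpσ, hpτ⟩, hmax⟩ := ((hcompact hσ).inter (hcompact hτ)).exists_isMaxOn
    ⟨r, hσ.left_mem, hτ.left_mem⟩ (f := fun p => dist r p)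
    (continuous_const.dist continuous_id).continuousOn
  have ha := hσ.dist_add_dist hpσ
  have hb := hτ.dist_add_dist hpτ
  refine ⟨p, ha, hb, ?_⟩
  obtain ⟨α, hα⟩ := hT.isGeodesicSpace a p
  obtain ⟨β, hβ⟩ := hT.isGeodesicSpace p b
  refine (hT.2 a p b α β hα hβ ?_).dist_add_dist (Or.inl hα.right_mem)
  refine eq_singleton_iff_unique_mem.2 ⟨⟨hα.right_mem, hβ.left_mem⟩, fun z ⟨hzα, hzβ⟩ => ?_⟩
  have e1 := hα.dist_add_dist hzα
  have e2 := hβ.dist_add_dist hzβ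
  rw [dist_comm a z, dist_comm z p, dist_comm a p] at e1
  have t1 := dist_triangle r p z
  have t2 := dist_triangle r z a
  have t3 := dist_triangle r z b
  have hz : z ∈ σ ∩ τ :=
    ⟨hT.mem_segment hσ (by linarith), hT.mem_segment hτ (by linarith)⟩
  have : dist r z ≤ dist r p := hmax hz
  exact (dist_le_zero.1 (by linarith)).symm

/-! ### Gromov products -/

/-- The Gromov product of `x` and `y` based at `r`. -/
noncomputable def gromovProduct (r x y : T) : ℝ := (dist r x + dist r y - dist x y) / 2

theorem gromovProduct_comm (r x y : T) : gromovProduct r x y = gromovProduct r y x := by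
  simp only [gromovProduct, dist_comm x y]
  ring

theorem gromovProduct_self (r x : T) : gromovProduct r x x = dist r x := by
  simp [gromovProduct]

theorem gromovProduct_nonneg (r x y : T) : 0 ≤ gromovProduct r x y := by
  have := dist_triangle_left x y r
  rw [gromovProduct]
  linarith

theorem gromovProduct_le_left (r x y : T) : gromovProduct r x y ≤ dist r x := by
  have := dist_triangle r x y
  rw [gromovProduct]
  linarith

theorem gromovProduct_le_right (r x y : T) : gromovProduct r x y ≤ dist r y := by
  rw [gromovProduct_comm]
  exact gromovProduct_le_left r y x

/-- Two segments issuing from `r` have a common point at distance equal to the Gromov product of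
their endpoints. -/
theorem IsRealTree.exists_dist_eq_gromovProduct (hT : IsRealTree T) (r a b : T) :
    ∃ p, dist r p = gromovProduct r a b ∧ dist r p + dist p a = dist r a ∧
      dist r p + dist p b = dist r b ∧ dist a p + dist p b = dist a b := by
  obtain ⟨p, h1, h2, h3⟩ := hT.exists_median r a b
  refine ⟨p, ?_, h1, h2, h3⟩
  rw [dist_comm a p] at h3
  rw [gromovProduct]
  linarith

theorem le_gromovProduct {r a b p : T} (ha : dist r p + dist p a = dist r a)
    (hb : dist r p + dist p b = dist r b) : dist r p ≤ gromovProduct r a b := by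
  have := dist_triangle_left a b p
  rw [gromovProduct]
  linarith

/-- The medians of `r, a, b` and of `r, b, c` both lie on the segment from `r` to `b`, so the one
nearer to `r` lies on the segments to `a` and to `c`. -/
theorem IsRealTree.min_gromovProduct_le (hT : IsRealTree T) (r a b c : T) :
    min (gromovProduct r a b) (gromovProduct r b c) ≤ gromovProduct r a c := by
  have key : ∀ p q a b c : T, dist r p + dist p a = dist r a → dist r p + dist p b = dist r b →
      dist r q + dist q b = dist r b → dist r q + dist q c = dist r c → dist r p ≤ dist r q →
      dist r p ≤ gromovProduct r a c := by
    intro p q a b c hpa hpb hqb hqc hpq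
    refine le_gromovProduct hpa ?_
    have := hT.dist_add_dist_of_le hpb hqb hpq
    have := dist_triangle r p c
    have := dist_triangle p q c
    linarith
  obtain ⟨p, hp, hpa, hpb, -⟩ := hT.exists_dist_eq_gromovProduct r a b
  obtain ⟨q, hq, hqb, hqc, -⟩ := hT.exists_dist_eq_gromovProduct r b c
  rw [← hp, ← hq]
  rcases le_total (dist r p) (dist r q) with h | h
  · rw [min_eq_left h]
    exact key p q a b c hpa hpb hqb hqc h
  · rw [min_eq_right h, gromovProduct_comm]
    exact key q p c b a hqc hqb hpb hpa h

end RealTree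

/-! ### The space `S` is a real tree -/

namespace PathSpace

theorem dist_def (f g : PathSpace) :
    dist f g = (f.ρ - segregation f g) + (g.ρ - segregation f g) := rfl

theorem segregation_comm (f g : PathSpace) : segregation f g = segregation g f := by
  rw [segregation, agreeSet_comm, segregation]

theorem segregation_nonneg (f g : PathSpace) : 0 ≤ segregation f g := (segregation_mem f g).1

theorem segregation_le_left (f g : PathSpace) : segregation f g ≤ f.ρ := (segregation_mem f g).2.1

theorem segregation_le_right (f g : PathSpace) : segregation f g ≤ g.ρ :=
  (segregation_mem f g).2.2.1

theorem eq_of_lt_segregation {f g : PathSpace} {t : ℝ} (h0 : 0 ≤ t) (h : t < segregation f g) :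
    f.toFun t = g.toFun t := (segregation_mem f g).2.2.2 t h0 h

theorem le_segregation {f g : PathSpace} {t : ℝ} (hf : t ≤ f.ρ) (hg : t ≤ g.ρ)
    (h : ∀ t', 0 ≤ t' → t' < t → f.toFun t' = g.toFun t') : t ≤ segregation f g := by
  rcases le_total 0 t with h0 | h0
  · exact le_csSup (bddAbove_agreeSet f g) ⟨h0, hf, hg, h⟩
  · exact h0.trans (segregation_nonneg f g)

theorem segregation_eq {f g : PathSpace} {s : ℝ} (hf : s ≤ f.ρ) (hg : s ≤ g.ρ)
    (h : ∀ t, 0 ≤ t → t < s → f.toFun t = g.toFun t)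
    (h' : ∀ u, s < u → u ≤ f.ρ → u ≤ g.ρ → ∃ t, 0 ≤ t ∧ t < u ∧ f.toFun t ≠ g.toFun t) :
    segregation f g = s := by
  refine le_antisymm ?_ (le_segregation hf hg h)
  by_contra! hlt
  obtain ⟨t, ht0, ht, hne⟩ := h' _ hlt (segregation_le_left f g) (segregation_le_right f g)
  exact hne (eq_of_lt_segregation ht0 ht)

/-- The path given by a continuous function on the line, cut off at `r`. -/
noncomputable def ofFun (r : ℝ) (hr : 0 ≤ r) (f : ℝ → ℝ) (hf : ContinuousOn f (Icc 0 r))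
    (h0 : f 0 = 0) : PathSpace where
  ρ := r
  toFun := (Icc 0 r).indicator f
  ρ_nonneg := hr
  continuousOn_toFun := hf.congr fun _ ht => indicator_of_mem ht f
  map_zero := by rw [indicator_of_mem (show (0 : ℝ) ∈ Icc 0 r from ⟨le_rfl, hr⟩), h0]
  eq_zero_of_notMem _ ht := indicator_of_notMem ht f

theorem ofFun_apply {r : ℝ} {hr : 0 ≤ r} {f : ℝ → ℝ} {hf : ContinuousOn f (Icc 0 r)}
    {h0 : f 0 = 0} {t : ℝ} (ht : t ∈ Icc 0 r) : (ofFun r hr f hf h0).toFun t = f t :=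
  indicator_of_mem ht f

@[simp]
theorem ofFun_ρ {r : ℝ} {hr : 0 ≤ r} {f : ℝ → ℝ} {hf : ContinuousOn f (Icc 0 r)}
    {h0 : f 0 = 0} : (ofFun r hr f hf h0).ρ = r := rfl

/-- The initial piece of a path, of length `t`. -/
noncomputable def initial (f : PathSpace) (t : ℝ) (ht : t ∈ Icc 0 f.ρ) : PathSpace :=
  ofFun t ht.1 f.toFun (f.continuousOn_toFun.mono (Icc_subset_Icc_right ht.2)) f.map_zero

theorem segregation_initial (f : PathSpace) {s t : ℝ} (hs : s ∈ Icc 0 f.ρ) (ht : t ∈ Icc 0 f.ρ) :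
    segregation (f.initial s hs) (f.initial t ht) = min s t := by
  refine le_antisymm (le_min (segregation_le_left _ _) (segregation_le_right _ _)) ?_
  refine le_segregation (min_le_left _ _) (min_le_right _ _) fun u h0 hu => ?_
  obtain ⟨h1, h2⟩ := lt_min_iff.1 hu
  rw [initial, initial, ofFun_apply ⟨h0, h1.le⟩, ofFun_apply ⟨h0, h2.le⟩]

theorem initial_self (f : PathSpace) : f.initial f.ρ ⟨f.ρ_nonneg, le_rfl⟩ = f := by
  refine PathSpace.ext rfl (funext fun t => ?_)
  by_cases ht : t ∈ Icc 0 f.ρ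
  · exact ofFun_apply ht
  · rw [f.eq_zero_of_notMem t ht]
    exact indicator_of_notMem ht _

/-- Agreement is known only strictly before the moment of segregation; continuity, used through
`eq_of_segregation`, supplies the value at that moment. -/
theorem initial_eq_initial (f g : PathSpace) (hf : segregation f g ∈ Icc 0 f.ρ)
    (hg : segregation f g ∈ Icc 0 g.ρ) : f.initial _ hf = g.initial _ hg := by
  have key : segregation f g ≤ segregation (f.initial _ hf) (g.initial _ hg) := by
    refine le_segregation le_rfl le_rfl fun u h0 hu => ?_
    rw [initial, initial, ofFun_apply ⟨h0, hu.le⟩, ofFun_apply ⟨h0, hu.le⟩]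
    exact eq_of_lt_segregation h0 hu
  exact eq_of_segregation (le_antisymm (segregation_le_left _ _) key)
    (le_antisymm (segregation_le_right _ _) key)

theorem exists_isGeodesicSegment_initial (f : PathSpace) {t : ℝ} (ht : t ∈ Icc 0 f.ρ) :
    ∃ σ, IsGeodesicSegment (f.initial t ht) f σ := by
  have hd : dist (f.initial t ht) f = f.ρ - t := by
    have := segregation_initial f ht ⟨f.ρ_nonneg, le_rfl⟩
    rw [initial_self, min_eq_left ht.2] at this
    rw [dist_def, this, initial, ofFun_ρ]
    ring
  refine ⟨_, fun s => if hs : t + s ∈ Icc 0 f.ρ then f.initial (t + s) hs else f, ?_, ?_, ?_, rfl⟩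
  · rw [hd]
    intro s hs u hu
    have hs' : t + s ∈ Icc 0 f.ρ := ⟨by linarith [ht.1, hs.1], by linarith [hs.2]⟩
    have hu' : t + u ∈ Icc 0 f.ρ := ⟨by linarith [ht.1, hu.1], by linarith [hu.2]⟩
    simp only [dif_pos hs', dif_pos hu']
    rw [dist_def, segregation_initial, initial, initial, ofFun_ρ, ofFun_ρ]
    rcases le_total s u with h | h
    · rw [min_eq_left (by linarith), abs_of_nonpos (by linarith)]
      ring
    · rw [min_eq_right (by linarith), abs_of_nonneg (by linarith)]
      ring
  · simp [ht.1, ht.2]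
  · simp [hd, f.ρ_nonneg, initial_self]

theorem isGeodesicSpace : IsGeodesicSpace PathSpace := by
  intro f g
  have hf : segregation f g ∈ Icc 0 f.ρ := ⟨segregation_nonneg f g, segregation_le_left f g⟩
  have hg : segregation f g ∈ Icc 0 g.ρ := ⟨segregation_nonneg f g, segregation_le_right f g⟩
  obtain ⟨σ, hσ⟩ := exists_isGeodesicSegment_initial f hf
  obtain ⟨τ, hτ⟩ := exists_isGeodesicSegment_initial g hg
  rw [← initial_eq_initial f g hf hg] at hτ
  refine ⟨_, hσ.symm.union hτ ?_⟩
  have h1 := segregation_initial f ⟨f.ρ_nonneg, le_rfl⟩ hf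
  rw [initial_self, min_eq_right hf.2] at h1
  have h2 := segregation_initial g hg ⟨g.ρ_nonneg, le_rfl⟩
  rw [initial_self, min_eq_left hg.2, ← initial_eq_initial f g hf hg] at h2
  rw [dist_def, dist_def, dist_def, h1, h2, initial, ofFun_ρ]
  ring

/-- The lengths contribute equally to all three sums of distances, so the claim concerns sums of
segregation times only. There it is a purely order-theoretic consequence of the ultrametric
inequality. -/
theorem fourPointCondition : FourPointCondition PathSpace := by
  intro x y z w
  have key : ∀ a b c d e f : ℝ, min c f ≤ a → min e d ≤ a → min c e ≤ b → min f d ≤ b →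
      min a f ≤ c → min a d ≤ e → min a c ≤ f → min a e ≤ d → c + d ≤ a + b ∨ e + f ≤ a + b := by
    intro a b c d e f
    simp only [min_le_iff]
    intros
    by_contra! hcon
    grind
  have h := key (segregation x y) (segregation z w) (segregation x z) (segregation y w)
    (segregation x w) (segregation y z)
    (by simpa only [segregation_comm z y] using min_segregation_le x z y)
    (by simpa only [segregation_comm w y] using min_segregation_le x w y)
    (by simpa only [segregation_comm z x] using min_segregation_le z x w)
    (by simpa only [segregation_comm z y] using min_segregation_le z y w)
    (min_segregation_le x y z) (min_segregation_le x y w)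
    (by simpa only [segregation_comm y x] using min_segregation_le y x z)
    (by simpa only [segregation_comm y x] using min_segregation_le y x w)
  simp only [dist_def, le_max_iff]
  rcases h with h | h
  · left; linarith
  · right; linarith

theorem isRealTree : IsRealTree PathSpace := isGeodesicSpace.isRealTree fourPointCondition

end PathSpace

/-! ### Homogeneity of the space `S` -/

namespace PathSpace

theorem ext_on {f g : PathSpace} (h : f.ρ = g.ρ) (h' : ∀ t ∈ Icc 0 f.ρ, f.toFun t = g.toFun t) :
    f = g := by
  refine PathSpace.ext h (funext fun t => ?_)
  by_cases ht : t ∈ Icc 0 f.ρ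
  · exact h' t ht
  · rw [f.eq_zero_of_notMem t ht, g.eq_zero_of_notMem t (h ▸ ht)]

/-- Addition of a fixed continuous function vanishing at the origin. -/
noncomputable def translate (b : ℝ → ℝ) (hb : Continuous b) (h0 : b 0 = 0) (f : PathSpace) :
    PathSpace :=
  ofFun f.ρ f.ρ_nonneg (fun t => f.toFun t + b t) (f.continuousOn_toFun.add hb.continuousOn)
    (by rw [f.map_zero, h0, add_zero])

section Translate

variable {b : ℝ → ℝ} {hb : Continuous b} {h0 : b 0 = 0}

@[simp]
theorem translate_ρ (f : PathSpace) : (translate b hb h0 f).ρ = f.ρ := rfl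

theorem translate_apply (f : PathSpace) {t : ℝ} (ht : t ∈ Icc 0 f.ρ) :
    (translate b hb h0 f).toFun t = f.toFun t + b t := ofFun_apply ht

theorem segregation_le_translate (f g : PathSpace) :
    segregation f g ≤ segregation (translate b hb h0 f) (translate b hb h0 g) := by
  refine le_segregation (segregation_le_left f g) (segregation_le_right f g) fun t ht0 ht => ?_
  rw [translate_apply f ⟨ht0, ht.le.trans (segregation_le_left f g)⟩,
    translate_apply g ⟨ht0, ht.le.trans (segregation_le_right f g)⟩, eq_of_lt_segregation ht0 ht]

theorem translate_translate {c : ℝ → ℝ} {hc : Continuous c} {hc0 : c 0 = 0}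
    (h : ∀ t, b t + c t = 0) (f : PathSpace) :
    translate c hc hc0 (translate b hb h0 f) = f := by
  refine ext_on rfl fun t (ht : t ∈ Icc 0 f.ρ) => ?_
  rw [translate_apply (translate b hb h0 f) ht, translate_apply f ht, add_assoc, h, add_zero]

theorem segregation_translate (f g : PathSpace) :
    segregation (translate b hb h0 f) (translate b hb h0 g) = segregation f g := by
  refine le_antisymm ?_ (segregation_le_translate f g)
  have h := segregation_le_translate (b := fun t => -b t) (hb := hb.neg) (h0 := by simp [h0])
    (translate b hb h0 f) (translate b hb h0 g)
  rwa [translate_translate fun t => add_neg_cancel (b t),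
    translate_translate fun t => add_neg_cancel (b t)] at h

variable (b hb h0) in
/-- Addition of a fixed continuous function, as an isometry. -/
noncomputable def translateEquiv : PathSpace ≃ᵢ PathSpace :=
  IsometryEquiv.mk' (translate b hb h0) (translate (fun t => -b t) hb.neg (by simp [h0]))
    (translate_translate fun t => neg_add_cancel (b t))
    (Isometry.of_dist_eq fun f g => by
      rw [dist_def, dist_def, segregation_translate, translate_ρ, translate_ρ])

end Translate

/-- The zero function on `[0, r]`. -/
noncomputable def zeroPath (r : ℝ) (hr : 0 ≤ r) : PathSpace :=
  ofFun r hr (fun _ => 0) continuousOn_const rfl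

theorem zeroPath_apply {r : ℝ} {hr : 0 ≤ r} (t : ℝ) : (zeroPath r hr).toFun t = 0 :=
  congrFun (indicator_zero ℝ (Icc 0 r)) t

theorem exists_isometryEquiv_zeroPath (f : PathSpace) :
    ∃ e : PathSpace ≃ᵢ PathSpace, e (zeroPath f.ρ f.ρ_nonneg) = f := by
  -- Clamping the time extends `f` continuously to the whole line, so that it can serve as a
  -- translation.
  have hmem : ∀ t, max 0 (min t f.ρ) ∈ Icc 0 f.ρ := fun t =>
    ⟨le_max_left _ _, max_le f.ρ_nonneg (min_le_right _ _)⟩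
  have hb : Continuous fun t => f.toFun (max 0 (min t f.ρ)) :=
    f.continuousOn_toFun.comp_continuous (by fun_prop) hmem
  have h0 : f.toFun (max 0 (min 0 f.ρ)) = 0 := by simp [f.ρ_nonneg, f.map_zero]
  refine ⟨translateEquiv _ hb h0, ext_on rfl fun t (ht : t ∈ Icc 0 f.ρ) => ?_⟩
  change (translate _ hb h0 (zeroPath f.ρ f.ρ_nonneg)).toFun t = _
  rw [translate_apply (zeroPath f.ρ f.ρ_nonneg) ht, zeroPath_apply, zero_add, min_eq_left ht.2,
    max_eq_right ht.1]

/-- The path that is zero for a time `s` and then follows `g`. -/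
noncomputable def shift (s : ℝ) (hs : 0 ≤ s) (g : PathSpace) : PathSpace :=
  ofFun (s + g.ρ) (add_nonneg hs g.ρ_nonneg) (fun t => g.toFun (max 0 (t - s)))
    (g.continuousOn_toFun.comp (by fun_prop) fun t ht =>
      ⟨le_max_left _ _, max_le g.ρ_nonneg (by linarith [ht.2])⟩)
    (by rw [zero_sub, max_eq_left (by linarith), g.map_zero])

@[simp]
theorem shift_ρ (s : ℝ) (hs : 0 ≤ s) (g : PathSpace) : (shift s hs g).ρ = s + g.ρ := rfl

theorem shift_apply {s : ℝ} {hs : 0 ≤ s} (g : PathSpace) {t : ℝ} (ht : t ∈ Icc 0 (s + g.ρ)) :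
    (shift s hs g).toFun t = g.toFun (max 0 (t - s)) := ofFun_apply ht

theorem shift_apply_add {s : ℝ} {hs : 0 ≤ s} (g : PathSpace) {t : ℝ} (ht : t ∈ Icc 0 g.ρ) :
    (shift s hs g).toFun (s + t) = g.toFun t := by
  rw [shift_apply g ⟨add_nonneg hs ht.1, by linarith [ht.2]⟩, add_sub_cancel_left,
    max_eq_right ht.1]

theorem shift_apply_of_le {s : ℝ} {hs : 0 ≤ s} (g : PathSpace) {t : ℝ} (h0 : 0 ≤ t) (ht : t ≤ s) :
    (shift s hs g).toFun t = 0 := by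
  rw [shift_apply g ⟨h0, by linarith [g.ρ_nonneg]⟩, max_eq_left (by linarith), g.map_zero]

theorem segregation_shift {s : ℝ} (hs : 0 ≤ s) (f g : PathSpace) :
    segregation (shift s hs f) (shift s hs g) = s + segregation f g := by
  refine segregation_eq (by simpa using segregation_le_left f g)
    (by simpa using segregation_le_right f g) (fun t h0 ht => ?_) fun u hu huf hug => ?_
  · rw [shift_apply f ⟨h0, by linarith [segregation_le_left f g]⟩,
      shift_apply g ⟨h0, by linarith [segregation_le_right f g]⟩]
    rcases le_total (t - s) 0 with h | h
    · rw [max_eq_left h, f.map_zero, g.map_zero]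
    · rw [max_eq_right h]
      exact eq_of_lt_segregation h (by linarith)
  · rw [shift_ρ] at huf hug
    by_contra! hcon
    have : u - s ≤ segregation f g := by
      refine le_segregation (by linarith) (by linarith) fun t h0 ht => ?_
      have := hcon (s + t) (by linarith) (by linarith)
      rwa [shift_apply_add f ⟨h0, by linarith⟩, shift_apply_add g ⟨h0, by linarith⟩] at this
    linarith

/-! ### Initial slopes and the Hilbert hotel shift -/

/-- The path starts as the linear function of slope `n`. -/
def HasSlope (f : PathSpace) (n : ℕ) : Prop :=
  ∃ δ, 0 < δ ∧ δ ≤ f.ρ ∧ ∀ t, 0 ≤ t → t < δ → f.toFun t = n * t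

theorem HasSlope.congr {f g : PathSpace} {n : ℕ} (h : f.HasSlope n) (hfg : 0 < segregation f g) :
    g.HasSlope n := by
  obtain ⟨δ, h0, -, h⟩ := h
  refine ⟨min δ (segregation f g), lt_min h0 hfg,
    (min_le_right _ _).trans (segregation_le_right f g), fun t ht0 ht => ?_⟩
  obtain ⟨h1, h2⟩ := lt_min_iff.1 ht
  rw [← eq_of_lt_segregation ht0 h2, h t ht0 h1]

theorem HasSlope.unique {f : PathSpace} {m n : ℕ} (hm : f.HasSlope m) (hn : f.HasSlope n) :
    m = n := by
  obtain ⟨δ, h0, -, h⟩ := hm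
  obtain ⟨δ', h0', -, h'⟩ := hn
  have hpos : 0 < min δ δ' / 2 := half_pos (lt_min h0 h0')
  have hlt : min δ δ' / 2 < min δ δ' := half_lt_self (lt_min h0 h0')
  have e := (h _ hpos.le (hlt.trans_le (min_le_left _ _))).symm.trans
    (h' _ hpos.le (hlt.trans_le (min_le_right _ _)))
  exact_mod_cast mul_right_cancel₀ hpos.ne' e

/-- A path without slope `0` vanishes on no initial interval of positive length in its domain, so
the first path leaves zero, or ends, at time `s`, while the second is still zero until `s'`. -/
theorem segregation_shift_of_lt {s s' : ℝ} (hs : 0 ≤ s) (hs' : 0 ≤ s') (h : s < s')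
    {f : PathSpace} (hf : ¬ f.HasSlope 0) (g : PathSpace) :
    segregation (shift s hs f) (shift s' hs' g) = s := by
  refine segregation_eq (by simpa using f.ρ_nonneg) (by rw [shift_ρ]; linarith [g.ρ_nonneg])
    (fun t h0 ht => ?_) fun u hu huf hug => ?_
  · rw [shift_apply_of_le f h0 ht.le, shift_apply_of_le g h0 (by linarith)]
  · rw [shift_ρ] at huf hug
    by_contra! hcon
    refine hf ⟨min (u - s) (s' - s), lt_min (by linarith) (by linarith),
      (min_le_left _ _).trans (by linarith), fun t h0 ht => ?_⟩
    obtain ⟨h1, h2⟩ := lt_min_iff.1 ht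
    have := hcon (s + t) (by linarith) (by linarith)
    rwa [shift_apply_add f ⟨h0, by linarith⟩,
      shift_apply_of_le g (by linarith) (by linarith), ← zero_mul t, ← Nat.cast_zero] at this

open Classical in
/-- Lowers positive integral slopes at the origin by one, so that the paths which do not start
as zero are mapped bijectively onto all paths. -/
noncomputable def lowerSlope (f : PathSpace) : PathSpace :=
  if ∃ n, f.HasSlope (n + 1) then translate (fun t => -t) continuous_neg neg_zero f else f

@[simp]
theorem lowerSlope_ρ (f : PathSpace) : (lowerSlope f).ρ = f.ρ := by
  unfold lowerSlope
  split_ifs <;> rfl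

theorem HasSlope.translate_neg {f : PathSpace} {n : ℕ} (h : f.HasSlope (n + 1)) :
    (translate (fun t => -t) continuous_neg neg_zero f).HasSlope n := by
  obtain ⟨δ, h0, h1, h⟩ := h
  refine ⟨δ, h0, h1, fun t ht0 ht => ?_⟩
  rw [translate_apply f ⟨ht0, by linarith⟩, h t ht0 ht]
  push_cast
  ring

theorem HasSlope.translate_id {f : PathSpace} {n : ℕ} (h : f.HasSlope n) :
    (translate (fun t => t) continuous_id rfl f).HasSlope (n + 1) := by
  obtain ⟨δ, h0, h1, h⟩ := h
  refine ⟨δ, h0, h1, fun t ht0 ht => ?_⟩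
  rw [translate_apply f ⟨ht0, by linarith⟩, h t ht0 ht]
  push_cast
  ring

/-- Only the mixed case matters: one path has a positive integral slope, the other has no natural
slope at all. They then separate at time `0`, and still do after lowering, since the first keeps a
natural slope. -/
theorem segregation_lowerSlope {f g : PathSpace} (hf : ¬ f.HasSlope 0) (hg : ¬ g.HasSlope 0) :
    segregation (lowerSlope f) (lowerSlope g) = segregation f g := by
  have key : ∀ {f g : PathSpace}, ¬ g.HasSlope 0 → (∃ n, f.HasSlope (n + 1)) →
      (¬ ∃ n, g.HasSlope (n + 1)) →
      segregation (translate (fun t => -t) continuous_neg neg_zero f) g = segregation f g := by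
    rintro f g hg ⟨n, hn⟩ hg'
    have h1 : segregation f g = 0 := by
      refine le_antisymm (not_lt.1 fun h => hg' ⟨n, hn.congr h⟩) (segregation_nonneg _ _)
    rw [h1]
    refine le_antisymm (not_lt.1 fun h => ?_) (segregation_nonneg _ _)
    have := hn.translate_neg.congr h
    cases n with
    | zero => exact hg this
    | succ n => exact hg' ⟨n, this⟩
  unfold lowerSlope
  split_ifs with h1 h2 h2
  · exact segregation_translate f g
  · exact key hg h1 h2
  · rw [segregation_comm, key hf h2 h1, segregation_comm]
  · rfl

theorem exists_lowerSlope_eq (f : PathSpace) : ∃ g, ¬ g.HasSlope 0 ∧ lowerSlope g = f := by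
  by_cases h : ∃ n, f.HasSlope n
  · obtain ⟨n, hn⟩ := h
    refine ⟨translate (fun t => t) continuous_id rfl f,
      fun h0 => n.succ_ne_zero (hn.translate_id.unique h0), ?_⟩
    rw [lowerSlope, if_pos ⟨n, hn.translate_id⟩]
    exact translate_translate (fun t => add_neg_cancel t) f
  · push Not at h
    exact ⟨f, h 0, if_neg fun ⟨n, hn⟩ => h _ hn⟩

/-- The remainder of `f` after leaving the zero path cannot start as zero unless the zero path ended
there: otherwise the agreement would last longer. -/
theorem exists_shift_eq (f : PathSpace) {r : ℝ} (hr : 0 ≤ r) :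
    ∃ g, f = shift (segregation f (zeroPath r hr)) (segregation_nonneg _ _) g ∧
      (segregation f (zeroPath r hr) < r → ¬ g.HasSlope 0) := by
  set z := zeroPath r hr
  set s := segregation f z with hs
  have hs0 : 0 ≤ s := segregation_nonneg f z
  have hsf : s ≤ f.ρ := segregation_le_left f z
  have hsz : s ≤ r := segregation_le_right f z
  have hfs : f.toFun s = 0 := by
    have := congrArg (fun k => toFun k s) (initial_eq_initial f z ⟨hs0, hsf⟩ ⟨hs0, hsz⟩)
    simp only [initial] at this
    rwa [ofFun_apply ⟨hs0, le_rfl⟩, ofFun_apply ⟨hs0, le_rfl⟩, zeroPath_apply] at this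
  have hz : ∀ t, 0 ≤ t → t ≤ s → f.toFun t = 0 := by
    intro t h0 ht
    rcases ht.eq_or_lt with rfl | h
    · exact hfs
    · rw [eq_of_lt_segregation h0 h, zeroPath_apply]
  refine ⟨ofFun (f.ρ - s) (by linarith) (fun t => f.toFun (s + t))
    (f.continuousOn_toFun.comp (by fun_prop) fun t ht => ⟨by linarith [ht.1], by linarith [ht.2]⟩)
    (by rw [add_zero, hfs]), ?_, ?_⟩
  · refine ext_on (by rw [shift_ρ, ofFun_ρ, add_sub_cancel]) fun t ht => ?_
    rw [shift_apply _ (by rwa [ofFun_ρ, add_sub_cancel]), ofFun_apply]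
    · rcases le_total t s with h | h
      · rw [max_eq_left (by linarith), add_zero, hfs, hz t ht.1 h]
      · rw [max_eq_right (by linarith), add_sub_cancel]
    · exact ⟨le_max_left _ _, max_le (by linarith) (by linarith [ht.2])⟩
  · rintro hlt ⟨δ, h0, h1, h⟩
    rw [ofFun_ρ] at h1
    have : min (s + δ) r ≤ s := by
      refine le_segregation ((min_le_left _ _).trans (by linarith)) (min_le_right _ _)
        fun t ht0 ht => ?_
      rw [zeroPath_apply]
      rcases le_total t s with hts | hts
      · exact hz t ht0 hts
      · have h2 := (lt_min_iff.1 ht).1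
        have := h (t - s) (by linarith) (by linarith)
        rwa [ofFun_apply ⟨by linarith, by linarith⟩, add_sub_cancel, Nat.cast_zero,
          zero_mul] at this
    rcases min_le_iff.1 this with h | h <;> linarith

/-! ### Branch coordinates and reflection of the zero segment -/

section Reflection

variable {r : ℝ}

open Classical in
/-- The path that leaves the zero path of length `r` at time `s` along the branch `g`. Paths that
continue the zero path until `r` are encoded by `lowerSlope`. -/
noncomputable def branch (p : Icc 0 r × {g : PathSpace // ¬ g.HasSlope 0}) : PathSpace :=
  shift p.1 p.1.2.1 (if (p.1 : ℝ) < r then p.2 else lowerSlope p.2)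

theorem branch_ρ (p : Icc 0 r × {g : PathSpace // ¬ g.HasSlope 0}) :
    (branch p).ρ = p.1 + p.2.1.ρ := by
  unfold branch
  split_ifs <;> simp

theorem segregation_branch (s : Icc 0 r) (f g : {g : PathSpace // ¬ g.HasSlope 0}) :
    segregation (branch (s, f)) (branch (s, g)) = s + segregation f.1 g := by
  unfold branch
  rw [segregation_shift]
  split_ifs
  · rfl
  · rw [segregation_lowerSlope f.2 g.2]

theorem segregation_branch_of_lt {s t : Icc 0 r} (h : s < t)
    (f g : {g : PathSpace // ¬ g.HasSlope 0}) :
    segregation (branch (s, f)) (branch (t, g)) = s := by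
  have hs : (s : ℝ) < r := lt_of_lt_of_le h t.2.2
  rw [branch, branch]
  simp only [if_pos hs]
  exact segregation_shift_of_lt s.2.1 t.2.1 h f.2 _

open Classical in
-- The departure times enter only through their equality and their distance, so any isometry of `[0,
-- r]` acts isometrically on the first coordinate.
theorem dist_branch (p q : Icc 0 r × {g : PathSpace // ¬ g.HasSlope 0}) :
    dist (branch p) (branch q) =
      if p.1 = q.1 then dist p.2.1 q.2.1 else dist p.1 q.1 + p.2.1.ρ + q.2.1.ρ := by
  obtain ⟨s, f⟩ := p
  obtain ⟨t, g⟩ := q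
  rw [dist_def, branch_ρ, branch_ρ, Subtype.dist_eq, Real.dist_eq]
  rcases lt_trichotomy s t with h | rfl | h
  · have h' : (s : ℝ) < t := h
    rw [if_neg h.ne, segregation_branch_of_lt h, abs_of_neg (by simpa using h')]
    ring
  · rw [if_pos rfl, segregation_branch, dist_def]
    ring
  · have h' : (t : ℝ) < s := h
    rw [if_neg h.ne', segregation_comm, segregation_branch_of_lt h, abs_of_pos (by simpa using h')]
    ring

theorem branch_bijective (hr : 0 ≤ r) : Function.Bijective (branch (r := r)) := by
  constructor
  · intro p q h
    have h1 := dist_branch p q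
    rw [h, dist_self] at h1
    split_ifs at h1 with h2
    · exact Prod.ext h2 (Subtype.ext (dist_eq_zero.1 h1.symm))
    · have := dist_pos.2 h2
      linarith [p.2.1.ρ_nonneg, q.2.1.ρ_nonneg]
  · intro f
    obtain ⟨g, hg, hslope⟩ := exists_shift_eq f hr
    by_cases h : segregation f (zeroPath r hr) < r
    · refine ⟨(⟨_, segregation_nonneg _ _, segregation_le_right f (zeroPath r hr)⟩, ⟨g, hslope h⟩), ?_⟩
      rw [branch]
      simp only [if_pos h]
      exact hg.symm
    · obtain ⟨k, hk, rfl⟩ := exists_lowerSlope_eq g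
      refine ⟨(⟨_, segregation_nonneg _ _, segregation_le_right f (zeroPath r hr)⟩, ⟨k, hk⟩), ?_⟩
      rw [branch]
      simp only [if_neg h]
      exact hg.symm

theorem exists_isometryEquiv_zeroPath_zero (hr : 0 ≤ r) :
    ∃ e : PathSpace ≃ᵢ PathSpace, e (zeroPath 0 le_rfl) = zeroPath r hr := by
  let b := Equiv.ofBijective _ (branch_bijective hr)
  let rev : Icc 0 r → Icc 0 r := fun s => ⟨r - s, by linarith [s.2.2], by linarith [s.2.1]⟩
  have hrev : Function.Involutive rev := fun s => Subtype.ext (by simp [rev])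
  let e : PathSpace ≃ PathSpace :=
    b.symm.trans ((Equiv.prodCongr hrev.toPerm (Equiv.refl _)).trans b)
  have he : ∀ p, e (b p) = b (rev p.1, p.2) := fun p => by simp [e, hrev.coe_toPerm, Prod.map]
  refine ⟨⟨e, Isometry.of_dist_eq fun f g => ?_⟩, ?_⟩
  · obtain ⟨p, rfl⟩ := b.surjective f
    obtain ⟨q, rfl⟩ := b.surjective g
    change dist (e (b p)) (e (b q)) = _
    rw [he, he]
    simp only [b, Equiv.ofBijective_apply, dist_branch, hrev.injective.eq_iff]
    congr 3
    rw [Subtype.dist_eq, Subtype.dist_eq, dist_sub_left]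
  · have hslope : ∀ n, ¬ (zeroPath 0 le_rfl).HasSlope n := fun n ⟨δ, h0, h1, _⟩ => h0.not_ge h1
    have h0 : (zeroPath 0 le_rfl).ρ = 0 := rfl
    have key : ∀ s : Icc 0 r, branch (s, ⟨_, hslope 0⟩) = zeroPath s s.2.1 := by
      intro s
      refine ext_on (by rw [branch_ρ, h0, add_zero]; rfl) fun t ht => ?_
      rw [branch_ρ, h0, add_zero] at ht
      rw [zeroPath_apply, branch, shift_apply_of_le _ ht.1 ht.2]
    have := he (⟨0, le_rfl, hr⟩, ⟨_, hslope 0⟩)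
    simp only [b, Equiv.ofBijective_apply, key] at this
    simpa [rev] using this

end Reflection

theorem isHomogeneousSpace : IsHomogeneousSpace PathSpace := by
  have key : ∀ f, ∃ e : PathSpace ≃ᵢ PathSpace, e (zeroPath 0 le_rfl) = f := fun f => by
    obtain ⟨e, he⟩ := exists_isometryEquiv_zeroPath f
    obtain ⟨e', he'⟩ := exists_isometryEquiv_zeroPath_zero f.ρ_nonneg
    exact ⟨e'.trans e, by rw [IsometryEquiv.trans_apply, he', he]⟩
  intro f g
  obtain ⟨e, rfl⟩ := key f
  obtain ⟨e', rfl⟩ := key g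
  exact ⟨e.symm.trans e', by simp⟩

end PathSpace

/-! ### The space `S` as an asymptotic subcone of the hyperbolic plane -/

/-- In `arsinh x = log (x + √(1 + x ^ 2))` the exponential factors out and gives `δ`; the logarithm
of the remaining factor converges, so the scaling kills it. -/
theorem tendsto_arsinh_exp_mul {L : ℕ → ℝ} {l δ : ℝ} (hL : Tendsto L atTop (𝓝 l)) (hl : 0 < l)
    (hδ : 0 < δ) :
    Tendsto (fun i : ℕ => ((i : ℝ) + 1)⁻¹ * Real.arsinh (Real.exp (((i : ℝ) + 1) * δ) * L i))
      atTop (𝓝 δ) := by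
  have hR : Tendsto (fun i : ℕ => (i : ℝ) + 1) atTop atTop :=
    tendsto_atTop_add_const_right _ _ tendsto_natCast_atTop_atTop
  have hE : Tendsto (fun i : ℕ => Real.exp (-(((i : ℝ) + 1) * δ))) atTop (𝓝 0) :=
    Real.tendsto_exp_neg_atTop_nhds_zero.comp (hR.atTop_mul_const hδ)
  have hM : Tendsto (fun i : ℕ =>
      L i + √(Real.exp (-(((i : ℝ) + 1) * δ)) ^ 2 + L i ^ 2)) atTop (𝓝 (l + √(0 ^ 2 + l ^ 2))) :=
    hL.add (((hE.pow 2).add (hL.pow 2)).sqrt)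
  have hpos : 0 < l + √(0 ^ 2 + l ^ 2) := by positivity
  have hlim := ((hM.log hpos.ne').mul hR.inv_tendsto_atTop).const_add δ
  rw [mul_zero, add_zero] at hlim
  refine hlim.congr' ?_
  filter_upwards [hM.eventually (lt_mem_nhds hpos)] with i hi
  have hi0 : (0 : ℝ) < (i : ℝ) + 1 := by positivity
  set a := ((i : ℝ) + 1) * δ with ha
  have key : Real.exp a * L i + √(1 + (Real.exp a * L i) ^ 2) =
      Real.exp a * (L i + √(Real.exp (-a) ^ 2 + L i ^ 2)) := by
    rw [mul_add]
    congr 1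
    conv_rhs => rw [← Real.sqrt_sq (Real.exp_pos a).le]
    rw [← Real.sqrt_mul (sq_nonneg _), Real.exp_neg]
    congr 1
    field_simp
  rw [Real.arsinh, key, Real.log_mul (Real.exp_pos a).ne' hi.ne', Real.log_exp, ha, Pi.inv_apply]
  field_simp

theorem tendsto_exp_mul_of_nonpos {c : ℝ} (hc : c ≤ 0) :
    Tendsto (fun i : ℕ => Real.exp (((i : ℝ) + 1) * c)) atTop (𝓝 (if c = 0 then 1 else 0)) := by
  split_ifs with h
  · simp [h]
  · have hR : Tendsto (fun i : ℕ => (i : ℝ) + 1) atTop atTop :=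
      tendsto_atTop_add_const_right _ _ tendsto_natCast_atTop_atTop
    exact Real.tendsto_exp_atBot.comp (hR.atTop_mul_const_of_neg (lt_of_le_of_ne hc h))

theorem UpperHalfPlane.exists_lt_dist (C : ℝ) : ∃ x y : UpperHalfPlane, C < dist x y := by
  let z : UpperHalfPlane := ⟨⟨0, Real.exp (C + 1)⟩, Real.exp_pos _⟩
  let w : UpperHalfPlane := ⟨⟨0, 1⟩, one_pos⟩
  refine ⟨z, w, ?_⟩
  rw [UpperHalfPlane.dist_of_re_eq (z := z) (w := w) rfl, Real.dist_eq]
  change C < |Real.log (Real.exp (C + 1)) - Real.log 1|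
  rw [Real.log_exp, Real.log_one, sub_zero]
  linarith [le_abs_self (C + 1)]

/-- Points of the upper half plane whose heights and horizontal distances decay exponentially. -/
theorem UpperHalfPlane.tendsto_dist_exp {a b s A : ℝ} (hsa : s ≤ a) (hsb : s ≤ b)
    (hab : 2 * s < a + b) {z w : ℕ → UpperHalfPlane}
    (hz : ∀ i : ℕ, (z i).im = Real.exp (-(((i : ℝ) + 1) * a)))
    (hw : ∀ i : ℕ, (w i).im = Real.exp (-(((i : ℝ) + 1) * b)))
    (hA : A ≠ 0) (hx : Tendsto (fun i : ℕ => Real.exp (((i : ℝ) + 1) * s) * ((z i).re - (w i).re))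
      atTop (𝓝 A)) :
    Tendsto (fun i : ℕ => ((i : ℝ) + 1)⁻¹ * dist (z i) (w i)) atTop (𝓝 (a - s + (b - s))) := by
  have hy : Tendsto (fun i : ℕ => Real.exp (((i : ℝ) + 1) * s) * ((z i).im - (w i).im)) atTop
      (𝓝 ((if s - a = 0 then 1 else 0) - (if s - b = 0 then 1 else 0))) := by
    refine ((tendsto_exp_mul_of_nonpos (sub_nonpos.2 hsa)).sub
      (tendsto_exp_mul_of_nonpos (sub_nonpos.2 hsb))).congr fun i => ?_
    rw [hz, hw, mul_sub, mul_sub, mul_sub, Real.exp_sub, Real.exp_sub, Real.exp_neg, Real.exp_neg,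
      div_eq_mul_inv, div_eq_mul_inv]
  set B : ℝ := (if s - a = 0 then 1 else 0) - (if s - b = 0 then 1 else 0)
  have hL := (((hx.pow 2).add (hy.pow 2)).sqrt).div_const 2
  -- The vertical limit `B` may vanish; `A ≠ 0` alone fixes the order of the Euclidean distance at
  -- `exp (-R s)`.
  have hpos : 0 < √(A ^ 2 + B ^ 2) / 2 := by positivity
  have h := (tendsto_arsinh_exp_mul hL hpos (δ := (a + b) / 2 - s) (by linarith)).const_mul 2
  rw [show a - s + (b - s) = 2 * ((a + b) / 2 - s) by ring]
  refine h.congr fun i => ?_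
  rw [UpperHalfPlane.dist_eq, mul_left_comm]
  congr 3
  set R : ℝ := (i : ℝ) + 1
  have e1 : √((Real.exp (R * s) * ((z i).re - (w i).re)) ^ 2 +
      (Real.exp (R * s) * ((z i).im - (w i).im)) ^ 2) =
      Real.exp (R * s) * dist (z i : ℂ) (w i) := by
    rw [Complex.dist_eq_re_im, mul_pow, mul_pow, ← mul_add, Real.sqrt_mul (sq_nonneg _),
      Real.sqrt_sq (Real.exp_pos _).le]
    rfl
  have e2 : √((z i).im * (w i).im) = Real.exp (-(R * ((a + b) / 2))) := by
    rw [hz, hw, ← Real.exp_add, ← Real.exp_half]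
    congr 1
    ring
  rw [e1, e2, Real.exp_neg, mul_sub, Real.exp_sub]
  field_simp

namespace PathSpace

theorem segregation_eq_of_lt {f g k : PathSpace} (h : segregation f k < segregation f g) :
    segregation g k = segregation f k := by
  have h1 := min_segregation_le g f k
  have h2 := min_segregation_le f g k
  rw [segregation_comm g f] at h1
  rw [min_eq_right h.le] at h1
  rcases min_le_iff.1 h2 with h3 | h3
  · exact absurd h3 (not_le.2 h)
  · exact le_antisymm h3 h1

theorem le_segregation_iff_of_le {f g k : PathSpace} :
    segregation f g ≤ segregation f k ↔ segregation f g ≤ segregation g k := by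
  have h1 := min_segregation_le g f k
  have h2 := min_segregation_le f g k
  rw [segregation_comm g f] at h1
  constructor
  · intro h
    rwa [min_eq_left h] at h1
  · intro h
    rwa [min_eq_left h] at h2

/-- If `k` leaves `f` before `g` does, it leaves `g` at the same time and the terms cancel.
Otherwise each rescaled exponential tends to `1` if `k` separates exactly at the moment `f` and `g`
do, and to `0` if later. -/
theorem tendsto_exp_sub_exp (f g k : PathSpace) :
    Tendsto (fun i : ℕ => Real.exp (((i : ℝ) + 1) * segregation f g) *
      (Real.exp (-(((i : ℝ) + 1) * segregation f k)) -
        Real.exp (-(((i : ℝ) + 1) * segregation g k)))) atTop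
      (𝓝 ((if segregation f g < segregation g k then 1 else 0) -
        (if segregation f g < segregation f k then 1 else 0))) := by
  set s := segregation f g with hs
  rcases lt_or_ge (segregation f k) s with h | h
  · rw [segregation_eq_of_lt h, sub_self]
    simp
  · have h' := le_segregation_iff_of_le.1 h
    have hlim := (tendsto_exp_mul_of_nonpos (sub_nonpos.2 h)).sub
      (tendsto_exp_mul_of_nonpos (sub_nonpos.2 h'))
    have e : ∀ t, s ≤ t → (if s - t = 0 then (1 : ℝ) else 0) = 1 - if s < t then 1 else 0 := by
      intro t ht
      rcases ht.eq_or_lt with rfl | ht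
      · simp
      · rw [if_neg (by linarith), if_pos ht, sub_self]
    rw [e _ h, e _ h', sub_sub_sub_cancel_left] at hlim
    refine hlim.congr fun i => ?_
    rw [mul_sub, mul_sub, mul_sub, Real.exp_sub, Real.exp_sub, Real.exp_neg, Real.exp_neg,
      div_eq_mul_inv, div_eq_mul_inv]

theorem embedsAtInfinity {F : Set PathSpace} (hF : F.Finite) :
    EmbedsAtInfinity F UpperHalfPlane := by
  have := hF.to_subtype
  have := Fintype.ofFinite F
  obtain ⟨idx⟩ : Nonempty (F ↪ ℕ) := ⟨(Fintype.equivFin F).toEmbedding.trans Fin.valEmbedding⟩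
  have hR : Tendsto (fun i : ℕ => (i : ℝ) + 1) atTop atTop :=
    tendsto_atTop_add_const_right _ _ tendsto_natCast_atTop_atTop
  refine ⟨fun i => ((i : ℝ) + 1)⁻¹, fun i => by positivity, hR.inv_tendsto_atTop,
    fun f i => ⟨⟨∑ k : F, 2 ^ idx k * Real.exp (-(((i : ℝ) + 1) * segregation f k)),
      Real.exp (-(((i : ℝ) + 1) * f.1.ρ))⟩, Real.exp_pos _⟩, fun f g => ?_⟩
  rcases eq_or_ne f g with rfl | hne
  · simp
  have hs1 := segregation_le_left f.1 g
  have hs2 := segregation_le_right f.1 g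
  have hlt : 2 * segregation f.1 g < f.1.ρ + g.1.ρ := by
    have := dist_pos.2 (Subtype.coe_ne_coe.2 hne)
    rw [dist_def] at this
    linarith
  have hlim := tendsto_finsetSum Finset.univ fun (k : F) _ =>
    (tendsto_exp_sub_exp f.1 g k).const_mul ((2 : ℝ) ^ idx k)
  rw [Subtype.dist_eq, dist_def]
  refine UpperHalfPlane.tendsto_dist_exp hs1 hs2 hlt (fun i => rfl) (fun i => rfl) ?_
    (hlim.congr fun i => ?_)
  · set s := segregation f.1 g with hs
    simp only [mul_sub, mul_ite, mul_one, mul_zero]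
    rw [Finset.sum_sub_distrib, sub_ne_zero, ← Finset.sum_filter, ← Finset.sum_filter]
    -- By uniqueness of binary expansions, a vanishing limit forces the paths that stay with `g`
    -- beyond `s` to be those that stay with `f`. No path does both, so both sets are empty; but `f`
    -- or `g` itself outlasts `s`.
    intro h
    have h1 : (Finset.univ.filter fun k : F => s < segregation g.1 k).map idx =
        (Finset.univ.filter fun k : F => s < segregation f.1 k).map idx := by
      refine Finset.geomSum_injective le_rfl ?_
      simp only [Finset.sum_map]
      exact_mod_cast h
    rw [Finset.map_inj] at h1
    have h2 : ∀ k : F, s < segregation g.1 k ↔ s < segregation f.1 k := fun k => by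
      simpa using congrArg (k ∈ ·) h1
    have h3 : ∀ k : F, ¬ s < segregation f.1 k := fun k hk => by
      have := min_segregation_le f.1 k g
      rw [segregation_comm k.1] at this
      exact this.not_gt (lt_min hk ((h2 k).2 hk))
    have h4 := h3 f
    have h5 := (h2 g).not.2 (h3 g)
    rw [segregation_self] at h4 h5
    linarith
  · change _ = Real.exp _ * (∑ k : F, _ - ∑ k : F, _)
    rw [← Finset.sum_sub_distrib, Finset.mul_sum]
    refine Finset.sum_congr rfl fun k _ => ?_
    ring

theorem isAsymptoticSubcone : IsAsymptoticSubcone PathSpace UpperHalfPlane :=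
  ⟨UpperHalfPlane.exists_lt_dist, isGeodesicSpace, fun _ hF => embedsAtInfinity hF⟩

end PathSpace

/-! ### Thickness of the space `S` -/

/-- `p` lies on the segment from the root `r` to `t` and is different from `t`. -/
def IsBelow {T : Type u} [MetricSpace T] (r p t : T) : Prop :=
  dist r p + dist p t = dist r t ∧ p ≠ t

section Thick

variable {T : Type u} [MetricSpace T]

theorem IsRealTree.isBelow_of_lt_gromovProduct (hT : IsRealTree T) {r p t t' : T}
    (h : dist r p < gromovProduct r t t') (hp : IsBelow r p t) : IsBelow r p t' := by
  obtain ⟨q, hq, hqt, hqt', -⟩ := hT.exists_dist_eq_gromovProduct r t t'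
  have hpq := hT.dist_add_dist_of_le hp.1 hqt (by rw [hq]; exact h.le)
  constructor
  · have := dist_triangle r p t'
    have := dist_triangle p q t'
    linarith
  · rintro rfl
    exact (gromovProduct_le_right r t p).not_gt h

/-- The branches at each point `p` of a real tree with at most continuum many points can be
labelled by real numbers. -/
theorem IsRealTree.exists_branch_label (hT : IsRealTree T)
    (hcard : Cardinal.mk T ≤ Cardinal.continuum) (r : T) :
    ∃ L : T → T → ℝ, (∀ p t, L p t ∈ Icc (0 : ℝ) 1) ∧ (∀ p t, ¬ IsBelow r p t → L p t = 0) ∧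
      ∀ p t t', IsBelow r p t → IsBelow r p t' →
        (L p t = L p t' ↔ dist r p < gromovProduct r t t') := by
  classical
  obtain ⟨ι⟩ : Nonempty (T ↪ Icc (0 : ℝ) 1) := by
    rw [← Cardinal.lift_mk_le', Cardinal.mk_Icc_real zero_lt_one]
    simpa using hcard
  -- Classes are the branches beyond `p`. Equality is added because the strict inequality is not
  -- reflexive at points no farther from `r` than `p`.
  let S : T → Setoid T := fun p =>
    { r := fun t t' => t = t' ∨ dist r p < gromovProduct r t t'
      iseqv :=
        { refl := fun t => Or.inl rfl
          symm := by
            rintro t t' (rfl | h)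
            · exact Or.inl rfl
            · exact Or.inr (by rwa [gromovProduct_comm])
          trans := by
            rintro a b c (rfl | h) (rfl | h')
            · exact Or.inl rfl
            · exact Or.inr h'
            · exact Or.inr h
            · exact Or.inr ((lt_min h h').trans_le (hT.min_gromovProduct_le r a b c)) } }
  refine ⟨fun p t => if IsBelow r p t then ι (Quotient.mk (S p) t).out else 0, fun p t => ?_,
    fun p t h => if_neg h, fun p t t' h h' => ?_⟩
  · dsimp only
    split_ifs
    · exact (ι _).2
    · exact ⟨le_rfl, zero_le_one⟩
  · dsimp only
    rw [if_pos h, if_pos h', Subtype.coe_inj, ι.injective.eq_iff, Quotient.out_inj, Quotient.eq]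
    refine ⟨?_, Or.inr⟩
    rintro (rfl | h1)
    · rw [gromovProduct_self]
      linarith [h.1, dist_pos.2 h.2]
    · exact h1

/-! ### Amplitudes, ramps and the embedding -/

/-- The geometric bound makes the sum of ramps continuous. The quadratic bound makes the ramp of a
later point near `p k` negligible against the linear growth of the ramp at `p k`. The enumeration
may repeat, so positivity is claimed only at first occurrences. -/
theorem exists_amplitude (p : ℕ → T) : ∃ A : ℕ → ℝ, ∀ n, 0 ≤ A n ∧ A n ≤ (1 / 2) ^ n ∧
    (∀ k < n, A n ≤ (1 / 2) ^ n * dist (p n) (p k) ^ 2) ∧ ((∀ k < n, p n ≠ p k) → 0 < A n) := by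
  have key : ∀ n, ∃ a : ℝ, 0 ≤ a ∧ a ≤ 1 ∧ (∀ k < n, a ≤ dist (p n) (p k) ^ 2) ∧
      ((∀ k < n, p n ≠ p k) → 0 < a) := by
    intro n
    let s : Finset ℝ := insert 1 ((Finset.range n).image fun k => dist (p n) (p k) ^ 2)
    have hs : s.Nonempty := Finset.insert_nonempty _ _
    have hmem : s.min' hs = 1 ∨ ∃ k < n, dist (p n) (p k) ^ 2 = s.min' hs := by
      simpa [s, -Finset.min'_insert] using s.min'_mem hs
    refine ⟨s.min' hs, ?_, s.min'_le _ (Finset.mem_insert_self _ _), fun k hk => s.min'_le _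
      (Finset.mem_insert_of_mem (Finset.mem_image_of_mem _ (Finset.mem_range.2 hk))), fun h => ?_⟩
    · rcases hmem with h1 | ⟨k, -, h1⟩
      · rw [h1]; exact zero_le_one
      · rw [← h1]; positivity
    · rcases hmem with h1 | ⟨k, hk, h1⟩
      · rw [h1]; exact zero_lt_one
      · rw [← h1]; exact pow_pos (dist_pos.2 (h k hk)) 2
  choose a h0 h1 h2 h3 using key
  refine ⟨fun n => (1 / 2) ^ n * a n, fun n => ⟨?_, ?_, fun k hk => ?_, fun h => ?_⟩⟩
  · have := h0 n; positivity
  · exact mul_le_of_le_one_right (by positivity) (h1 n)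
  · exact mul_le_mul_of_nonneg_left (h2 n k hk) (by positivity)
  · have := h3 n h; positivity

/-- A ramp of height at most `A` that starts to grow at the time `c`. -/
noncomputable def ramp (c A u : ℝ) : ℝ := min (max 0 (u - c)) A

theorem ramp_of_le {c A u : ℝ} (hA : 0 ≤ A) (h : u ≤ c) : ramp c A u = 0 := by
  rw [ramp, max_eq_left (by linarith), min_eq_left hA]

theorem ramp_nonneg {c A : ℝ} (hA : 0 ≤ A) (u : ℝ) : 0 ≤ ramp c A u :=
  le_min (le_max_left _ _) hA

theorem ramp_le (c A u : ℝ) : ramp c A u ≤ A := min_le_right _ _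

theorem ramp_add {c A h : ℝ} (h0 : 0 ≤ h) (hA : h ≤ A) : ramp c A (c + h) = h := by
  rw [ramp, add_sub_cancel_left, max_eq_right h0, min_eq_left hA]

theorem continuous_ramp (c A : ℝ) : Continuous (ramp c A) := by
  unfold ramp
  fun_prop

theorem norm_mul_ramp_le {c A B l : ℝ} (hA : 0 ≤ A) (hB : A ≤ B) (hl : l ∈ Icc (0 : ℝ) 1) (u : ℝ) :
    ‖l * ramp c A u‖ ≤ B := by
  have h1 := ramp_nonneg (c := c) hA u
  rw [Real.norm_of_nonneg (mul_nonneg hl.1 h1)]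
  exact (mul_le_of_le_one_left h1 hl.2).trans ((ramp_le _ _ _).trans hB)

theorem IsRealTree.exists_isometry_pathSpace (hT : IsRealTree T)
    (hV : (treeVertices T).Countable) (hcard : Cardinal.mk T ≤ Cardinal.continuum) (r : T) :
    ∃ φ : T → PathSpace, Isometry φ := by
  classical
  obtain ⟨L, hL, hL0, hLeq⟩ := hT.exists_branch_label hcard r
  -- The root is added because segments from `r` may part at `r` itself, which need not be a vertex.
  obtain ⟨p, hp⟩ := (hV.insert r).exists_eq_range (insert_nonempty _ _)
  obtain ⟨A, hA⟩ := exists_amplitude p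
  have hbound : ∀ n t u, ‖L (p n) t * ramp (dist r (p n)) (A n) u‖ ≤ (1 / 2) ^ n := fun n t u =>
    norm_mul_ramp_le (hA n).1 (hA n).2.1 (hL _ _) u
  have hsum : ∀ t u, Summable fun n => L (p n) t * ramp (dist r (p n)) (A n) u := fun t u =>
    Summable.of_norm_bounded summable_geometric_two fun n => hbound n t u
  have hLcongr : ∀ n t t', dist r (p n) < gromovProduct r t t' → L (p n) t = L (p n) t' := by
    intro n t t' h
    by_cases hb : IsBelow r (p n) t
    · exact (hLeq _ _ _ hb (hT.isBelow_of_lt_gromovProduct h hb)).2 h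
    · rw [hL0 _ _ hb, hL0 _ _ fun hb' =>
        hb (hT.isBelow_of_lt_gromovProduct (by rwa [gromovProduct_comm]) hb')]
  have hcont : ∀ t, Continuous fun u => ∑' n, L (p n) t * ramp (dist r (p n)) (A n) u := fun t =>
    continuous_tsum (fun n => continuous_const.mul (continuous_ramp _ _)) summable_geometric_two
      fun n u => hbound n t u
  let φ : T → PathSpace := fun t => PathSpace.ofFun (dist r t) dist_nonneg
    (fun u => ∑' n, L (p n) t * ramp (dist r (p n)) (A n) u) (hcont t).continuousOn
    (by simp [ramp_of_le (hA _).1 dist_nonneg])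
  have hφ : ∀ t u, 0 ≤ u → u ≤ dist r t →
      (φ t).toFun u = ∑' n, L (p n) t * ramp (dist r (p n)) (A n) u := fun t u h0 h =>
    PathSpace.ofFun_apply ⟨h0, h⟩
  suffices hseg : ∀ t t', PathSpace.segregation (φ t) (φ t') = gromovProduct r t t' by
    refine ⟨φ, Isometry.of_dist_eq fun t t' => ?_⟩
    rw [PathSpace.dist_def, hseg, gromovProduct]
    change dist r t - _ + (dist r t' - _) = _
    ring
  intro t t'
  refine PathSpace.segregation_eq (gromovProduct_le_left r t t') (gromovProduct_le_right r t t')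
    (fun u h0 hu => ?_) fun u hu hut hut' => ?_
  · rw [hφ t u h0 (hu.le.trans (gromovProduct_le_left r t t')),
      hφ t' u h0 (hu.le.trans (gromovProduct_le_right r t t'))]
    refine tsum_congr fun n => ?_
    rcases lt_or_ge (dist r (p n)) (gromovProduct r t t') with h | h
    · rw [hLcongr n t t' h]
    · rw [ramp_of_le (hA n).1 (hu.le.trans h), mul_zero, mul_zero]
  · change u ≤ dist r t at hut
    change u ≤ dist r t' at hut'
    obtain ⟨q, hq, hqt, hqt', htt'⟩ := hT.exists_dist_eq_gromovProduct r t t'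
    have hqt_ne : q ≠ t := by rintro rfl; linarith
    have hqt'_ne : q ≠ t' := by rintro rfl; linarith
    -- If `q ≠ r`, then `t`, `t'` and `r` lie in three different directions at `q`, a branch point.
    have hqV : ∃ k, p k = q := by
      rw [← mem_range, ← hp]
      rcases eq_or_ne r q with rfl | hrq
      · exact mem_insert _ _
      · rw [dist_comm r q, dist_comm q t, dist_comm r t] at hqt
        rw [dist_comm r q, dist_comm q t', dist_comm r t'] at hqt'
        refine mem_insert_of_mem _ (Or.inl ⟨t, t', r, ⟨hqt_ne.symm, hqt'_ne.symm, htt'⟩,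
          ⟨hqt'_ne.symm, hrq, ?_⟩, ⟨hqt_ne.symm, hrq, ?_⟩⟩) <;> linarith
    obtain ⟨k, rfl, hk⟩ : ∃ k, p k = q ∧ ∀ n < k, p k ≠ p n :=
      ⟨Nat.find hqV, Nat.find_spec hqV, fun n hn => by
        rw [Nat.find_spec hqV]
        exact fun h => Nat.find_min hqV hn h.symm⟩
    have hlab : 0 < |L (p k) t - L (p k) t'| := by
      rw [abs_pos, sub_ne_zero, Ne, hLeq _ _ _ ⟨hqt, hqt_ne⟩ ⟨hqt', hqt'_ne⟩, hq]
      exact lt_irrefl _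
    have hAk := (hA k).2.2.2 hk
    -- The functions are compared at time `m + h`: `h < A k` keeps ramp `k` in its linear phase,
    -- `h3` lets its term dominate, and `h4` keeps the earlier vertices out of reach.
    obtain ⟨h, h0, h1, h2, h3, h4⟩ : ∃ h : ℝ, 0 < h ∧ h < u - gromovProduct r t t' ∧ h < A k ∧
        h < |L (p k) t - L (p k) t'| / 2 ∧ ∀ n ∈ Iio k, h < dist (p k) (p n) := by
      have hlt : ∀ c : ℝ, 0 < c → ∀ᶠ h in 𝓝[>] (0 : ℝ), h < c := fun c hc =>
        mem_nhdsWithin_of_mem_nhds (gt_mem_nhds hc)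
      have hev := (hlt (u - gromovProduct r t t') (by linarith)).and ((hlt (A k) hAk).and
        ((hlt _ (half_pos hlab)).and ((eventually_all_finite (finite_Iio k)).2 fun n hn =>
          hlt _ (dist_pos.2 (hk n hn)))))
      obtain ⟨h, hh, h0⟩ := (hev.and self_mem_nhdsWithin).exists
      exact ⟨h, h0, hh⟩
    have hm := gromovProduct_nonneg r t t'
    set m := gromovProduct r t t' with hm_def
    refine ⟨m + h, by linarith, by linarith, ?_⟩
    rw [hφ t _ (by linarith) (by linarith), hφ t' _ (by linarith) (by linarith), ← sub_ne_zero,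
      ← (hsum t _).tsum_sub (hsum t' _), ((hsum t _).sub (hsum t' _)).tsum_eq_add_tsum_ite k]
    -- A ramp that is active by time `m + h` has its vertex within `h` of `p k`. This excludes `n <
    -- k`, and for `n > k` the quadratic amplitude bound applies.
    have hsmall : ∀ n, n ≠ k → ∀ s, (s = t ∨ s = t') → m ≤ dist r (p n) → IsBelow r (p n) s →
        ramp (dist r (p n)) (A n) (m + h) ≤ (1 / 2) ^ n * h ^ 2 := by
      intro n hn s hs hmn hb
      have hks : dist r (p k) + dist (p k) s = dist r s := by
        rcases hs with rfl | rfl <;> assumption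
      have hd := hT.dist_add_dist_of_le hks hb.1 (by rw [hq]; exact hmn)
      rw [hq] at hd
      rcases le_or_gt (m + h) (dist r (p n)) with hle | hgt
      · rw [ramp_of_le (hA n).1 hle]
        positivity
      · rcases hn.lt_or_gt with hnk | hnk
        · have := h4 n hnk
          linarith
        · refine (ramp_le _ _ _).trans (((hA n).2.2.1 k hnk).trans ?_)
          rw [dist_comm]
          have : dist (p k) (p n) ≤ h := by linarith
          gcongr
    have hrest : ‖∑' n, ite (n = k) 0 (L (p n) t * ramp (dist r (p n)) (A n) (m + h) -
        L (p n) t' * ramp (dist r (p n)) (A n) (m + h))‖ ≤ 2 * h ^ 2 := by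
      refine tsum_of_norm_bounded (hasSum_geometric_two.mul_right (h ^ 2)) fun n => ?_
      split_ifs with hn
      · rw [norm_zero]
        positivity
      · rw [← sub_mul, norm_mul, Real.norm_of_nonneg (ramp_nonneg (hA n).1 _), Real.norm_eq_abs]
        by_cases heq : L (p n) t = L (p n) t'
        · rw [heq, sub_self, abs_zero, zero_mul]
          positivity
        · have hmn : m ≤ dist r (p n) := not_lt.1 fun hlt => heq (hLcongr n t t' hlt)
          have hle : |L (p n) t - L (p n) t'| ≤ 1 :=
            abs_le.2 ⟨by linarith [(hL (p n) t).1, (hL (p n) t').2],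
              by linarith [(hL (p n) t).2, (hL (p n) t').1]⟩
          refine (mul_le_of_le_one_left (ramp_nonneg (hA n).1 _) hle).trans ?_
          by_cases hb : IsBelow r (p n) t
          · exact hsmall n hn t (Or.inl rfl) hmn hb
          · by_cases hb' : IsBelow r (p n) t'
            · exact hsmall n hn t' (Or.inr rfl) hmn hb'
            · exact absurd ((hL0 _ _ hb).trans (hL0 _ _ hb').symm) heq
    -- Equal values would give `|L (p k) t - L (p k) t'| * h ≤ 2 * h ^ 2`, contrary to `h3`.
    intro hzero
    have hrk : ramp (dist r (p k)) (A k) (m + h) = h := by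
      rw [hq]
      exact ramp_add h0.le h2.le
    rw [hrk, ← sub_mul, add_eq_zero_iff_eq_neg] at hzero
    have hnorm := congrArg norm hzero
    rw [norm_neg, norm_mul, Real.norm_eq_abs, Real.norm_of_nonneg h0.le] at hnorm
    nlinarith

end Thick

theorem PathSpace.isThick : IsThick.{0, v} PathSpace := by
  refine ⟨PathSpace.isRealTree, fun T _ hT hV hcard => ?_⟩
  rcases isEmpty_or_nonempty T with h | ⟨⟨r⟩⟩
  · exact ⟨isEmptyElim, isometry_subsingleton⟩
  · exact hT.exists_isometry_pathSpace hV hcard r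

theorem theorem1p9 :
    IsRealTree PathSpace ∧
    IsThick.{0, v} PathSpace ∧
    IsHomogeneousSpace PathSpace ∧
    IsAsymptoticSubcone PathSpace UpperHalfPlane :=
  ⟨PathSpace.isRealTree, PathSpace.isThick, PathSpace.isHomogeneousSpace,
    PathSpace.isAsymptoticSubcone⟩
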